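/- Let $1\le p<\infty$ and let $h:[0,1]\to\mathbb{R}$ be continuous. For $t\ge 0$ put $$(T_h(t)v)(x)=\exp\Big(\int_{-t}^{0}h(xe^{s})\,ds\Big)\,v(xe^{-t}),\qquad x\in(0,1),$$ the von Foerster–Lasota semigroup (the weighted composition semigroup of the flow of $F(x)=-x$ with weight $h$). Let $W^{1,p}(0,1)$ be the space of all $u\in L^p(0,1)$ with distributional derivative $u'\in L^p(0,1)$, normed by $\|u\|_p+\|u'\|_p$, and let $W^{1,p}_*(0,1)$ be its closed subspace of those $u$ whose continuous representative on $[0,1]$ vanishes at $0$. Let $\mathcal{T}_h=(T_h(t))_{t\ge0}$ act on $L^p(0,1)$ and let $\mathcal{S}_h$ denote the restriction of $\mathcal{T}_h$ to $W^{1,p}(0,1)$. Such a semigroup is called stable on a space if each of its orbits starting in that space tends to $0$ in the norm of the space as $t\to\infty$. (a) If $x\mapsto \frac{h(x)-h(0)}{x}$ belongs to $L^1(0,1)$, then $\mathcal{T}_h$ is stable on $L^p(0,1)$ if and only if $h(0)\le -\frac1p$. (b) If $h\in W^{1,\infty}(0,1)$ and $x\mapsto \frac{h(x)-h(0)}{x}$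 belongs to $L^\infty(0,1)$, then $\mathcal{S}_h$ is stable on $W^{1,p}_*(0,1)$ if and only if $h(0)\le 1-\frac1p$. Moreover, $\mathcal{S}_h$ is stable on $W^{1,p}(0,1)$ if and only if $h(0)<0$. -/

import Mathlib

open MeasureTheory Filter Topology Set
open scoped ENNReal

namespace FoersterLasota

/-- Lebesgue measure on the open unit interval `(0, 1)`. -/
noncomputable def unitMeasure : Measure ℝ := volume.restrict (Ioo (0 : ℝ) 1)

/-- The von Foerster-Lasota semigroup
`(T_h(t) v)(x) = exp (∫_{-t}^0 h (x e^s) ds) v (x e^{-t})`, associated with `F x = -x`.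
Only its values for `t ≥ 0` and `x ∈ (0, 1)` matter, where it only uses `h` and `v`
on `(0, 1)`. -/
noncomputable def lasota (h : ℝ → ℝ) (t : ℝ) (v : ℝ → ℝ) (x : ℝ) : ℝ :=
  Real.exp (∫ s in (-t)..0, h (x * Real.exp s)) * v (x * Real.exp (-t))

/-- `g` is a distributional derivative of `u` on `(0, 1)`; both are locally integrable there. -/
def HasWeakDeriv (u g : ℝ → ℝ) : Prop :=
  LocallyIntegrableOn u (Ioo (0 : ℝ) 1) ∧ LocallyIntegrableOn g (Ioo (0 : ℝ) 1) ∧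
    ∀ φ : ℝ → ℝ, ContDiff ℝ ((⊤ : ℕ∞) : WithTop ℕ∞) φ → HasCompactSupport φ → tsupport φ ⊆ Ioo (0 : ℝ) 1 →
      ∫ x in Ioo (0 : ℝ) 1, u x * deriv φ x = -∫ x in Ioo (0 : ℝ) 1, g x * φ x

/-- The functions of class `L^p(0, 1)`. -/
def lpSpace (p : ℝ≥0∞) : Set (ℝ → ℝ) :=
  {u | MemLp u p unitMeasure}

/-- The norm of `L^p(0, 1)`. -/
noncomputable def lpNorm (p : ℝ≥0∞) (u : ℝ → ℝ) : ℝ≥0∞ :=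
  eLpNorm u p unitMeasure

/-- The functions of class `W^{1,p}(0, 1)`. -/
def sobolev (p : ℝ≥0∞) : Set (ℝ → ℝ) :=
  {u | MemLp u p unitMeasure ∧ ∃ g, HasWeakDeriv u g ∧ MemLp g p unitMeasure}

/-- The norm `‖u‖_p + ‖u'‖_p` of `W^{1,p}(0, 1)`. The weak derivative `u'` is unique up to
null sets, so the infimum is over a single value; it is `∞` if `u` has no weak derivative. -/
noncomputable def sobolevNorm (p : ℝ≥0∞) (u : ℝ → ℝ) : ℝ≥0∞ :=
  eLpNorm u p unitMeasure + ⨅ (g : ℝ → ℝ) (_ : HasWeakDeriv u g), eLpNorm g p unitMeasure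

/-- `W^{1,p}_*(0, 1)`, the kernel of the evaluation at `0`: the elements of `W^{1,p}(0, 1)` whose
representative in `C[0, 1]` vanishes at `0`. -/
def sobolevStar (p : ℝ≥0∞) : Set (ℝ → ℝ) :=
  {u | u ∈ sobolev p ∧
    ∃ w : ℝ → ℝ, ContinuousOn w (Icc (0 : ℝ) 1) ∧ w =ᵐ[unitMeasure] u ∧ w 0 = 0}

/-- Stability of a family of operators `T t` on a space `X` with norm `N`: every orbit that
starts in `X` tends to `0` in norm. -/
def IsStableOn (T : ℝ → (ℝ → ℝ) → ℝ → ℝ) (X : Set (ℝ → ℝ)) (N : (ℝ → ℝ) → ℝ≥0∞) : Prop :=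
  ∀ u ∈ X, Tendsto (fun t => N (T t u)) atTop (𝓝 0)

end FoersterLasota

namespace FoersterLasota

/-! Substituting `y = x * exp s` turns the exponent of the weight into `h 0 * t` plus the integral
of `r y = (h y - h 0) / y` from `x * exp (-t)` to `x` (`integral_comp_mul_exp`). If `r` is
integrable, the weight lies between two constant multiples of `exp (h 0 * t)`, so `h` behaves like
the constant `h 0`.

For a constant weight `a`, the `p`-th power of the `L^p` norm of the orbit of `v` is `exp ((a * p +
1) * t)` times the integral of `|v|^p` over `(0, exp (-t))`; it tends to `0` when `a ≤ -1/p`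
(`tendsto_eLpNorm_exp_mul_comp`). When `a > -1/p`, the fixed point `x ^ a` lies in `L^p` and
stability fails.

On the Sobolev space, `u` is a.e. a primitive `U = c + ∫ g` of its weak derivative. The derivative
of its orbit is the weight times a bounded multiple of `U (x * exp (-t))`, plus an `L^p` orbit of
`g` with exponent `h 0 - 1`; hence the threshold `h 0 - 1 ≤ -1/p`. The remaining terms need `exp (h
0 * t) * U (x * exp (-t))` to vanish uniformly: under that threshold this holds if `c = 0`, and in
general if `h 0 < 0`. The counterexamples are `x ^ h 0` and the constant `1`. -/

instance isProbabilityMeasure_unitMeasure : IsProbabilityMeasure unitMeasure :=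
  ⟨by simp [unitMeasure]⟩

/-! ### Weak derivatives and absolutely continuous representatives -/

theorem exists_Ioo_of_tsupport {φ : ℝ → ℝ} (hs : HasCompactSupport φ)
    (hφ : tsupport φ ⊆ Ioo (0 : ℝ) 1) :
    ∃ a b, 0 < a ∧ a < b ∧ b < 1 ∧ tsupport φ ⊆ Ioo a b := by
  rcases (tsupport φ).eq_empty_or_nonempty with he | hne
  · exact ⟨1 / 4, 3 / 4, by norm_num, by norm_num, by norm_num, by simp [he]⟩
  have hK : IsCompact (tsupport φ) := hs
  obtain ⟨m, hm, hm'⟩ := hK.exists_isLeast hne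
  obtain ⟨M, hM, hM'⟩ := hK.exists_isGreatest hne
  have h1 := hφ hm
  have h2 := hφ hM
  have h3 : m ≤ M := hm' hM
  refine ⟨m / 2, (M + 1) / 2, by linarith [h1.1], by linarith [h1.1, h2.2], by linarith [h2.2],
    fun x hx => ⟨?_, ?_⟩⟩
  · have := hm' hx
    linarith [h1.1]
  · have := hM' hx
    linarith [h2.2]

theorem eq_zero_of_notMem_Ioo {φ : ℝ → ℝ} {a b x : ℝ} (hφ : tsupport φ ⊆ Ioo a b)
    (hx : x ∉ Ioo a b) : φ x = 0 :=
  image_eq_zero_of_notMem_tsupport fun h => hx (hφ h)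

theorem setIntegral_unit_eq_intervalIntegral {f : ℝ → ℝ} {a b : ℝ} (ha : 0 < a) (hab : a < b)
    (hb : b < 1) (hf : ∀ x, x ∉ Ioo a b → f x = 0) :
    ∫ x in Ioo (0 : ℝ) 1, f x = ∫ x in a..b, f x := by
  rw [intervalIntegral.integral_of_le hab.le, integral_Ioc_eq_integral_Ioo]
  refine (setIntegral_eq_of_subset_of_forall_sdiff_eq_zero measurableSet_Ioo
    (Ioo_subset_Ioo ha.le hb.le) fun x hx => hf x hx.2)

/-- A function that is absolutely continuous on the compact subintervals of `(0, 1)` has its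
pointwise derivative as weak derivative. -/
theorem hasWeakDeriv_of_absolutelyContinuous {u g : ℝ → ℝ}
    (hu : ∀ a b, 0 < a → a < b → b < 1 → AbsolutelyContinuousOnInterval u a b)
    (hg : ∀ᵐ x, x ∈ Ioo (0 : ℝ) 1 → HasDerivAt u (g x) x) : HasWeakDeriv u g := by
  have key : ∀ a b, 0 < a → a < b → b < 1 → IntervalIntegrable g volume a b := by
    intro a b ha hab hb
    refine (hu a b ha hab hb).intervalIntegrable_deriv.congr_ae ?_
    rw [uIoc_of_le hab.le]
    filter_upwards [ae_restrict_of_ae hg, ae_restrict_mem measurableSet_Ioc] with x hx hx'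
    exact (hx ⟨ha.trans hx'.1, hx'.2.trans_lt hb⟩).deriv
  have hnb : ∀ x ∈ Ioo (0 : ℝ) 1, ∃ a b, 0 < a ∧ a < b ∧ b < 1 ∧
      Icc a b ∈ 𝓝[Ioo (0 : ℝ) 1] x := by
    intro x hx
    refine ⟨x / 2, (x + 1) / 2, by linarith [hx.1], by linarith [hx.1, hx.2], by linarith [hx.2],
      mem_nhdsWithin_of_mem_nhds (Icc_mem_nhds (by linarith [hx.1]) (by linarith [hx.2]))⟩
  refine ⟨fun x hx => ?_, fun x hx => ?_, fun φ hφ hs hsub => ?_⟩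
  · obtain ⟨a, b, ha, hab, hb, hn⟩ := hnb x hx
    refine ⟨_, hn, ?_⟩
    have := (hu a b ha hab hb).continuousOn
    rw [uIcc_of_le hab.le] at this
    exact this.integrableOn_Icc
  · obtain ⟨a, b, ha, hab, hb, hn⟩ := hnb x hx
    refine ⟨_, hn, ?_⟩
    rw [integrableOn_Icc_iff_integrableOn_Ioc,
      ← intervalIntegrable_iff_integrableOn_Ioc_of_le hab.le]
    exact key a b ha hab hb
  · obtain ⟨a, b, ha, hab, hb, hn⟩ := exists_Ioo_of_tsupport hs hsub
    have hφ0 : ∀ x, x ∉ Ioo a b → φ x = 0 := fun x => eq_zero_of_notMem_Ioo hn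
    have hφ'0 : ∀ x, x ∉ Ioo a b → deriv φ x = 0 := fun x hx =>
      image_eq_zero_of_notMem_tsupport fun h => hx (hn (tsupport_deriv_subset h))
    rw [setIntegral_unit_eq_intervalIntegral ha hab hb fun x hx => by simp [hφ'0 x hx],
      setIntegral_unit_eq_intervalIntegral ha hab hb fun x hx => by simp [hφ0 x hx]]
    have hφac : AbsolutelyContinuousOnInterval φ a b :=
      ContDiffOn.absolutelyContinuousOnInterval (hφ.of_le (by exact_mod_cast le_top)).contDiffOn
    rw [AbsolutelyContinuousOnInterval.integral_mul_deriv_eq_deriv_mul (hu a b ha hab hb) hφac,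
      hφ0 a (by simp), hφ0 b (by simp)]
    simp only [mul_zero, sub_zero, zero_sub, neg_inj]
    refine intervalIntegral.integral_congr_ae ?_
    filter_upwards [hg] with x hx hx'
    rw [uIoc_of_le hab.le] at hx'
    rw [(hx ⟨ha.trans hx'.1, hx'.2.trans_lt hb⟩).deriv]

theorem HasWeakDeriv.congr {u v g : ℝ → ℝ} (hu : HasWeakDeriv u g) (huv : u =ᵐ[unitMeasure] v) :
    HasWeakDeriv v g := by
  refine ⟨fun x hx => ?_, hu.2.1, fun φ h1 h2 h3 => ?_⟩
  · obtain ⟨s, hs, hi⟩ := hu.1 x hx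
    refine ⟨s ∩ Ioo (0 : ℝ) 1, inter_mem hs self_mem_nhdsWithin, ?_⟩
    refine (hi.mono_set inter_subset_left).congr ?_
    exact ae_restrict_of_ae_restrict_of_subset inter_subset_right huv
  · rw [← hu.2.2 φ h1 h2 h3]
    refine integral_congr_ae ?_
    filter_upwards [huv] with x hx
    rw [hx]

theorem absolutelyContinuousOnInterval_const_add_primitive {g : ℝ → ℝ}
    (hg : IntegrableOn g (Ioo 0 1)) (c : ℝ) {a b : ℝ} (ha : 0 ≤ a) (hab : a ≤ b) (hb : b ≤ 1) :
    AbsolutelyContinuousOnInterval (fun x => c + ∫ y in (0 : ℝ)..x, g y) a b := by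
  have h1 : IntervalIntegrable g volume 0 1 := by
    rwa [intervalIntegrable_iff_integrableOn_Ioo_of_le zero_le_one]
  have h2 := h1.absolutelyContinuousOnInterval_intervalIntegral (c := 0) (by simp)
  have h3 : AbsolutelyContinuousOnInterval (fun _ : ℝ => c) 0 1 :=
    ContDiffOn.absolutelyContinuousOnInterval contDiffOn_const
  refine (h3.add h2).mono ?_
  rw [uIcc_of_le hab, uIcc_of_le zero_le_one]
  exact Icc_subset_Icc ha hb

theorem ae_hasDerivAt_const_add_primitive {g : ℝ → ℝ} (hg : IntegrableOn g (Ioo 0 1)) (c : ℝ) :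
    ∀ᵐ x, x ∈ Ioo (0 : ℝ) 1 → HasDerivAt (fun x => c + ∫ y in (0 : ℝ)..x, g y) (g x) x := by
  have h1 : IntervalIntegrable g volume 0 1 := by
    rwa [intervalIntegrable_iff_integrableOn_Ioo_of_le zero_le_one]
  filter_upwards [h1.ae_hasDerivAt_integral] with x hx hx'
  refine (hx ?_ 0 (by simp)).const_add c
  rw [uIcc_of_le zero_le_one]
  exact Ioo_subset_Icc_self hx'

theorem hasWeakDeriv_const_add_primitive {g : ℝ → ℝ} (hg : IntegrableOn g (Ioo 0 1)) (c : ℝ) :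
    HasWeakDeriv (fun x => c + ∫ y in (0 : ℝ)..x, g y) g :=
  hasWeakDeriv_of_absolutelyContinuous
    (fun _ _ ha hab hb =>
      absolutelyContinuousOnInterval_const_add_primitive hg c ha.le hab.le hb.le)
    (ae_hasDerivAt_const_add_primitive hg c)

/-- A test function on `(0, 1)` with integral zero is the derivative of a test function. -/
theorem exists_primitive_testFunction {φ : ℝ → ℝ}
    (hφ : ContDiff ℝ ((⊤ : ℕ∞) : WithTop ℕ∞) φ) (hs : HasCompactSupport φ)
    (hsub : tsupport φ ⊆ Ioo (0 : ℝ) 1) (h0 : ∫ x in Ioo (0 : ℝ) 1, φ x = 0) :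
    ∃ Φ : ℝ → ℝ, ContDiff ℝ ((⊤ : ℕ∞) : WithTop ℕ∞) Φ ∧ HasCompactSupport Φ ∧
      tsupport Φ ⊆ Ioo (0 : ℝ) 1 ∧ deriv Φ = φ := by
  obtain ⟨a, b, ha, hab, hb, hn⟩ := exists_Ioo_of_tsupport hs hsub
  have hφ0 : ∀ x, x ∉ Ioo a b → φ x = 0 := fun x => eq_zero_of_notMem_Ioo hn
  have hd : ∀ x, HasDerivAt (fun x => ∫ y in a..x, φ y) (φ x) x := fun x =>
    hφ.continuous.integral_hasStrictDerivAt a x |>.hasDerivAt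
  have hderiv : deriv (fun x => ∫ y in a..x, φ y) = φ := funext fun x => (hd x).deriv
  rw [setIntegral_unit_eq_intervalIntegral ha hab hb hφ0] at h0
  have hz : ∀ x, x ∉ Icc a b → ∫ y in a..x, φ y = 0 := by
    intro x hx
    rcases lt_or_ge x a with hxa | hxa
    · refine intervalIntegral.integral_zero_ae (Eventually.of_forall fun y hy => hφ0 y ?_)
      rw [uIoc_of_ge hxa.le] at hy
      exact fun h => absurd hy.2 (not_le.2 h.1)
    · have hxb : b < x := lt_of_not_ge fun h => hx ⟨hxa, h⟩
      -- To the right of `b` the primitive equals the total integral of `φ`, which is zero; this is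
      -- what makes its support compact.
      rw [← intervalIntegral.integral_add_adjacent_intervals
        (hφ.continuous.intervalIntegrable a b) (hφ.continuous.intervalIntegrable b x), h0, zero_add]
      refine intervalIntegral.integral_zero_ae (Eventually.of_forall fun y hy => hφ0 y ?_)
      rw [uIoc_of_le hxb.le] at hy
      exact fun h => absurd hy.1 (not_lt.2 h.2.le)
  have hts : tsupport (fun x => ∫ y in a..x, φ y) ⊆ Icc a b :=
    closure_minimal (fun x hx => by_contra fun h => hx (hz x h)) isClosed_Icc
  refine ⟨fun x => ∫ y in a..x, φ y, ?_, ?_, ?_, hderiv⟩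
  · exact contDiff_infty_iff_deriv.2 ⟨fun x => (hd x).differentiableAt, by rwa [hderiv]⟩
  · exact HasCompactSupport.intro isCompact_Icc hz
  · exact hts.trans (Icc_subset_Ioo ha hb)

theorem integrableOn_mul_testFunction {f φ : ℝ → ℝ} (hf : LocallyIntegrableOn f (Ioo (0 : ℝ) 1))
    (h1 : Continuous φ) (h2 : HasCompactSupport φ) (h3 : tsupport φ ⊆ Ioo (0 : ℝ) 1) :
    IntegrableOn (fun x => f x * φ x) (Ioo 0 1) := by
  obtain ⟨a, b, ha, hab, hb, hn⟩ := exists_Ioo_of_tsupport h2 h3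
  have hfi : IntegrableOn f (Icc a b) :=
    hf.integrableOn_compact_subset (Icc_subset_Ioo ha hb) isCompact_Icc
  have := hfi.mul_continuousOn h1.continuousOn isCompact_Icc
  exact (integrableOn_iff_integrable_of_support_subset (s := Icc a b) (fun x hx =>
    by_contra fun h => hx (by
      simp [eq_zero_of_notMem_Ioo hn fun h' => h (Ioo_subset_Icc_self h')]))).1 this |>.integrableOn

/-- The lemma of du Bois-Reymond. -/
theorem ae_eq_const_of_hasWeakDeriv_zero {f : ℝ → ℝ} (hf : HasWeakDeriv f 0) :
    ∃ c : ℝ, ∀ᵐ x ∂unitMeasure, f x = c := by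
  -- Any test function `ψ` of integral one would do; this one lives on `[1/4, 3/4]`.
  let B : ContDiffBump (1 / 2 : ℝ) := ⟨1 / 8, 1 / 4, by norm_num, by norm_num⟩
  let ψ : ℝ → ℝ := B.normed volume
  have hψ : ContDiff ℝ ((⊤ : ℕ∞) : WithTop ℕ∞) ψ := B.contDiff_normed
  have hψs : HasCompactSupport ψ := B.hasCompactSupport_normed
  have hψsub : tsupport ψ ⊆ Ioo (0 : ℝ) 1 := by
    rw [B.tsupport_normed_eq, Real.closedBall_eq_Icc]
    exact Icc_subset_Ioo (by norm_num [B]) (by norm_num [B])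
  have hψ1 : ∫ x in Ioo (0 : ℝ) 1, ψ x = 1 := by
    rw [setIntegral_eq_integral_of_forall_compl_eq_zero fun x hx => eq_zero_of_notMem_Ioo hψsub hx]
    exact B.integral_normed
  let c := ∫ x in Ioo (0 : ℝ) 1, f x * ψ x
  refine ⟨c, ?_⟩
  have hloc : LocallyIntegrableOn (fun x => f x - c) (Ioo (0 : ℝ) 1) :=
    hf.1.sub (continuousOn_const.locallyIntegrableOn measurableSet_Ioo)
  have key := isOpen_Ioo.ae_eq_zero_of_integral_contDiff_smul_eq_zero hloc
    (fun φ h1 h2 h3 => by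
      let m := ∫ x in Ioo (0 : ℝ) 1, φ x
      have hφi : IntegrableOn φ (Ioo (0 : ℝ) 1) :=
        (h1.continuous.integrable_of_hasCompactSupport h2).integrableOn
      have hψi : IntegrableOn ψ (Ioo (0 : ℝ) 1) :=
        (hψ.continuous.integrable_of_hasCompactSupport hψs).integrableOn
      have hmψs : HasCompactSupport (fun x => m * ψ x) := hψs.mul_left
      have hsub : tsupport (fun x => φ x - m * ψ x) ⊆ Ioo (0 : ℝ) 1 :=
        (tsupport_sub φ (fun x => m * ψ x)).trans
          (union_subset h3 ((tsupport_mul_subset_right (f := fun _ => m)).trans hψsub))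
      -- Subtracting `m * ψ` makes the integral zero, so the difference is some `Φ'`; testing `f`
      -- against `Φ` gives `∫ f φ = c ∫ φ`.
      obtain ⟨Φ, k1, k2, k3, k4⟩ := exists_primitive_testFunction
        (φ := fun x => φ x - m * ψ x) (h1.sub (contDiff_const.mul hψ)) (h2.sub hmψs) hsub
        (by rw [integral_sub hφi (hψi.const_mul m), integral_const_mul, hψ1]; simp [m])
      have h4 := hf.2.2 Φ k1 k2 k3
      rw [k4] at h4
      simp only [Pi.zero_apply, zero_mul, integral_zero, neg_zero] at h4
      have h5 : ∫ x in Ioo (0 : ℝ) 1, f x * (φ x - m * ψ x)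
          = (∫ x in Ioo (0 : ℝ) 1, f x * φ x) - m * c := by
        rw [← integral_const_mul, ← integral_sub (integrableOn_mul_testFunction hf.1 h1.continuous h2 h3)
          ((integrableOn_mul_testFunction hf.1 hψ.continuous hψs hψsub).const_mul m)]
        exact integral_congr_ae (Eventually.of_forall fun x => by simp only; ring)
      rw [← setIntegral_eq_integral_of_forall_compl_eq_zero (s := Ioo (0 : ℝ) 1)
        (fun x hx => by rw [eq_zero_of_notMem_Ioo h3 hx, zero_smul])]
      have h6 : ∫ x in Ioo (0 : ℝ) 1, φ x • (f x - c)
          = (∫ x in Ioo (0 : ℝ) 1, f x * φ x) - c * m := by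
        rw [← integral_const_mul, ← integral_sub (integrableOn_mul_testFunction hf.1 h1.continuous h2 h3) (hφi.const_mul c)]
        exact integral_congr_ae (Eventually.of_forall fun x => by simp only [smul_eq_mul]; ring)
      rw [h6]
      linarith [mul_comm m c])
  rw [unitMeasure, ae_restrict_iff' measurableSet_Ioo]
  filter_upwards [key] with x hx hx'
  linarith [hx hx']

theorem HasWeakDeriv.sub {u v f g : ℝ → ℝ} (hu : HasWeakDeriv u f) (hv : HasWeakDeriv v g) :
    HasWeakDeriv (u - v) (f - g) := by
  refine ⟨hu.1.sub hv.1, hu.2.1.sub hv.2.1, fun φ h1 h2 h3 => ?_⟩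
  have hd : Continuous (deriv φ) := h1.continuous_deriv (by exact_mod_cast le_top)
  have hd3 : tsupport (deriv φ) ⊆ Ioo (0 : ℝ) 1 := (tsupport_deriv_subset).trans h3
  simp only [Pi.sub_apply, sub_mul]
  rw [integral_sub (integrableOn_mul_testFunction hu.1 hd h2.deriv hd3)
      (integrableOn_mul_testFunction hv.1 hd h2.deriv hd3),
    integral_sub (integrableOn_mul_testFunction hu.2.1 h1.continuous h2 h3)
      (integrableOn_mul_testFunction hv.2.1 h1.continuous h2 h3), hu.2.2 φ h1 h2 h3,
    hv.2.2 φ h1 h2 h3]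
  ring

/-- A function with integrable weak derivative is a.e. equal to a primitive of it. -/
theorem HasWeakDeriv.exists_ae_eq_primitive {u g : ℝ → ℝ} (hu : HasWeakDeriv u g)
    (hg : IntegrableOn g (Ioo 0 1)) :
    ∃ c : ℝ, u =ᵐ[unitMeasure] fun x => c + ∫ y in (0 : ℝ)..x, g y := by
  have h := hu.sub (hasWeakDeriv_const_add_primitive hg 0)
  rw [sub_self] at h
  obtain ⟨c, hc⟩ := ae_eq_const_of_hasWeakDeriv_zero h
  refine ⟨c, ?_⟩
  filter_upwards [hc] with x hx
  simp only [Pi.sub_apply] at hx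
  linarith

/-! ### Dilations of the unit interval -/

theorem ae_unitMeasure_mem : ∀ᵐ x ∂unitMeasure, x ∈ Ioo (0 : ℝ) 1 :=
  ae_restrict_mem measurableSet_Ioo

theorem mul_exp_neg_mem_Ioo {x t : ℝ} (hx : x ∈ Ioo (0 : ℝ) 1) (ht : 0 ≤ t) :
    x * Real.exp (-t) ∈ Ioo (0 : ℝ) 1 :=
  ⟨mul_pos hx.1 (Real.exp_pos _),
    (mul_le_of_le_one_right hx.1.le (Real.exp_le_one_iff.2 (by linarith))).trans_lt hx.2⟩

theorem measurableEmbedding_mul_right {a : ℝ} (ha : 0 < a) :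
    MeasurableEmbedding (· * a : ℝ → ℝ) :=
  (Homeomorph.mulRight₀ a ha.ne').measurableEmbedding

theorem map_mul_right_unitMeasure {a : ℝ} (ha : 0 < a) :
    unitMeasure.map (· * a) = ENNReal.ofReal a⁻¹ • volume.restrict (Ioo 0 a) := by
  have hpre : (· * a) ⁻¹' (Ioo 0 a) = Ioo (0 : ℝ) 1 := by
    rw [preimage_mul_const_Ioo₀ _ _ ha]; simp [ha.ne']
  rw [unitMeasure, ← hpre, ← (measurableEmbedding_mul_right ha).restrict_map,
    Real.map_volume_mul_right ha.ne', Measure.restrict_smul, abs_of_pos (inv_pos.2 ha)]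

theorem lintegral_comp_mul_right_unit (F : ℝ → ℝ≥0∞) {a : ℝ} (ha : 0 < a) :
    ∫⁻ x, F (x * a) ∂unitMeasure = ENNReal.ofReal a⁻¹ * ∫⁻ y in Ioo 0 a, F y := by
  rw [← (measurableEmbedding_mul_right ha).lintegral_map, map_mul_right_unitMeasure ha,
    lintegral_smul_measure, smul_eq_mul]

theorem memLp_comp_mul_exp_neg {q : ℝ≥0∞} {v : ℝ → ℝ} (hv : MemLp v q unitMeasure) {t : ℝ}
    (ht : 0 ≤ t) : MemLp (fun x => v (x * Real.exp (-t))) q unitMeasure := by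
  have hle : volume.restrict (Ioo 0 (Real.exp (-t))) ≤ unitMeasure :=
    Measure.restrict_mono (Ioo_subset_Ioo le_rfl (Real.exp_le_one_iff.2 (by linarith))) le_rfl
  refine ((measurableEmbedding_mul_right (Real.exp_pos (-t))).memLp_map_measure_iff (g := v)).1 ?_
  rw [map_mul_right_unitMeasure (Real.exp_pos _)]
  exact (hv.mono_measure hle).smul_measure ENNReal.ofReal_ne_top

theorem ae_comp_mul_exp_neg {P : ℝ → Prop} (hP : ∀ᵐ x ∂unitMeasure, P x) {t : ℝ} (ht : 0 ≤ t) :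
    ∀ᵐ x ∂unitMeasure, P (x * Real.exp (-t)) := by
  have h1 : ∀ᵐ x, x ∈ Ioo (0 : ℝ) 1 → P x := (ae_restrict_iff' measurableSet_Ioo).1 hP
  have hq : Measure.QuasiMeasurePreserving (· * Real.exp (-t)) volume volume :=
    ⟨by fun_prop, by
      rw [Real.map_volume_mul_right (Real.exp_pos _).ne']
      exact Measure.smul_absolutelyContinuous⟩
  filter_upwards [ae_restrict_of_ae (hq.ae h1), ae_unitMeasure_mem] with x hx hx'
  exact hx (mul_exp_neg_mem_Ioo hx' ht)

/-- The decay comes from absolute continuity of the integral of `|v|^p` over the shrinking intervals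
`(0, exp (-t))`; the exponential factor only has to stay at most `1`, which is why the endpoint `a =
-1/p` is included. -/
theorem tendsto_eLpNorm_exp_mul_comp {p : ℝ} (hp : 1 ≤ p) {a : ℝ} (ha : a ≤ -(1 / p)) {v : ℝ → ℝ}
    (hv : MemLp v (ENNReal.ofReal p) unitMeasure) :
    Tendsto (fun t : ℝ => eLpNorm (fun x => Real.exp (a * t) * v (x * Real.exp (-t)))
      (ENNReal.ofReal p) unitMeasure) atTop (𝓝 0) := by
  have hp0 : 0 < p := by linarith
  have hq0 : ENNReal.ofReal p ≠ 0 := by simpa using hp0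
  have hqt : ENNReal.ofReal p ≠ ∞ := ENNReal.ofReal_ne_top
  have hpr : (ENNReal.ofReal p).toReal = p := ENNReal.toReal_ofReal hp0.le
  have hfin : ∫⁻ x, ‖v x‖ₑ ^ p ∂unitMeasure ≠ ∞ := by
    have := lintegral_rpow_enorm_lt_top_of_eLpNorm_lt_top hq0 hqt hv.2
    rw [hpr] at this
    exact this.ne
  have hvol : Tendsto (unitMeasure ∘ fun t : ℝ => Ioo 0 (Real.exp (-t))) atTop (𝓝 0) := by
    have h1 : Tendsto (fun t : ℝ => ENNReal.ofReal (Real.exp (-t))) atTop (𝓝 0) := by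
      have := ENNReal.tendsto_ofReal (Real.tendsto_exp_neg_atTop_nhds_zero)
      simpa using this
    refine tendsto_of_tendsto_of_tendsto_of_le_of_le tendsto_const_nhds h1 (fun _ => zero_le)
      fun t => ?_
    refine (Measure.restrict_apply_le _ _).trans ?_
    simp
  have hlim := tendsto_setLIntegral_zero hfin hvol
  have hpow := hlim.ennrpow_const (1 / p)
  rw [ENNReal.zero_rpow_of_pos (by positivity)] at hpow
  refine tendsto_of_tendsto_of_tendsto_of_le_of_le' tendsto_const_nhds hpow
    (Eventually.of_forall fun _ => zero_le) ?_
  filter_upwards [eventually_ge_atTop 0] with t ht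
  rw [eLpNorm_eq_lintegral_rpow_enorm_toReal hq0 hqt, hpr]
  refine ENNReal.rpow_le_rpow ?_ (by positivity)
  have h2 : ∀ x : ℝ, ‖Real.exp (a * t) * v (x * Real.exp (-t))‖ₑ ^ p
      = ENNReal.ofReal (Real.exp (a * t * p)) * ‖v (x * Real.exp (-t))‖ₑ ^ p := by
    intro x
    rw [enorm_mul, ENNReal.mul_rpow_of_nonneg _ _ hp0.le, Real.enorm_eq_ofReal (Real.exp_pos _).le,
      ENNReal.ofReal_rpow_of_pos (Real.exp_pos _), ← Real.exp_mul]
  simp_rw [h2]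
  rw [lintegral_const_mul' _ _ ENNReal.ofReal_ne_top,
    lintegral_comp_mul_right_unit (fun y => ‖v y‖ₑ ^ p) (Real.exp_pos (-t)), ← mul_assoc,
    ← ENNReal.ofReal_mul (Real.exp_pos _).le, ← Real.exp_neg, ← Real.exp_add]
  have h3 : Ioo 0 (Real.exp (-t)) ⊆ Ioo (0 : ℝ) 1 :=
    Ioo_subset_Ioo le_rfl (Real.exp_le_one_iff.2 (by linarith))
  have h4 : a * t * p + - -t ≤ 0 := by
    have : a * p ≤ -1 := by
      have := mul_le_mul_of_nonneg_right ha hp0.le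
      rwa [neg_mul, one_div, inv_mul_cancel₀ hp0.ne'] at this
    nlinarith
  rw [unitMeasure, Measure.restrict_restrict measurableSet_Ioo, inter_eq_left.2 h3]
  refine (mul_le_mul_left (ENNReal.ofReal_le_one.2 (Real.exp_le_one_iff.2 h4)) _).trans ?_
  rw [one_mul]

/-! ### The weight -/

theorem continuousOn_sub_div {h : ℝ → ℝ} (hc : ContinuousOn h (Icc (0 : ℝ) 1)) :
    ContinuousOn (fun x => (h x - h 0) / x) (Ioc (0 : ℝ) 1) :=
  ((hc.mono Ioc_subset_Icc_self).sub continuousOn_const).div continuousOn_id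
    fun _ hx => hx.1.ne'

theorem integral_comp_mul_exp {h : ℝ → ℝ} (hc : ContinuousOn h (Icc (0 : ℝ) 1)) {x t : ℝ}
    (hx : x ∈ Ioo (0 : ℝ) 1) (ht : 0 ≤ t) :
    ∫ s in (-t)..0, h (x * Real.exp s)
      = h 0 * t + ∫ y in (x * Real.exp (-t))..x, (h y - h 0) / y := by
  have hmap : ∀ s ∈ Icc (-t) 0, x * Real.exp s ∈ Ioc (0 : ℝ) 1 := fun s hs =>
    ⟨mul_pos hx.1 (Real.exp_pos _),
      (mul_le_of_le_one_right hx.1.le (Real.exp_le_one_iff.2 hs.2)).trans hx.2.le⟩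
  have hu : uIcc (-t) 0 = Icc (-t) 0 := uIcc_of_le (by linarith)
  have hsub := intervalIntegral.integral_comp_mul_deriv'' (a := -t) (b := 0)
    (f := fun s => x * Real.exp s) (f' := fun s => x * Real.exp s)
    (g := fun y => (h y - h 0) / y) (by fun_prop)
    (fun s _ => ((Real.hasDerivAt_exp s).const_mul x).hasDerivWithinAt) (by fun_prop)
    (by
      refine (continuousOn_sub_div hc).mono ?_
      rintro _ ⟨s, hs, rfl⟩
      exact hmap s (hu ▸ hs))
  simp only [Real.exp_zero, mul_one] at hsub
  rw [← hsub]
  have hint : IntervalIntegrable (fun s => h (x * Real.exp s)) volume (-t) 0 := by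
    refine ContinuousOn.intervalIntegrable ?_
    rw [hu]
    exact hc.comp (by fun_prop) fun s hs => Ioc_subset_Icc_self (hmap s hs)
  have h1 : ∫ s in (-t)..0, ((fun y => (h y - h 0) / y) ∘ fun s => x * Real.exp s) s
        * (x * Real.exp s) = ∫ s in (-t)..0, (h (x * Real.exp s) - h 0) := by
    refine intervalIntegral.integral_congr fun s hs => ?_
    have := (hmap s (hu ▸ hs)).1.ne'
    exact div_mul_cancel₀ _ this
  rw [h1, intervalIntegral.integral_sub hint (by simp), intervalIntegral.integral_const]
  simp
  ring

theorem abs_intervalIntegral_le_unit {r : ℝ → ℝ} (hr : IntegrableOn r (Ioo 0 1)) {a b : ℝ}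
    (ha : 0 ≤ a) (hab : a ≤ b) (hb : b ≤ 1) :
    |∫ y in a..b, r y| ≤ ∫ y in Ioo (0 : ℝ) 1, |r y| := by
  refine (intervalIntegral.abs_integral_le_integral_abs hab).trans ?_
  rw [intervalIntegral.integral_of_le hab, integral_Ioc_eq_integral_Ioo]
  exact setIntegral_mono_set hr.abs (Eventually.of_forall fun _ => abs_nonneg _)
    (Ioo_subset_Ioo ha hb).eventuallyLE

/-- The weight of the semigroup is comparable to `exp (h 0 * t)`. -/
theorem exists_bounds_weight {h : ℝ → ℝ} (hc : ContinuousOn h (Icc (0 : ℝ) 1))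
    (hr : MemLp (fun x => (h x - h 0) / x) 1 unitMeasure) :
    ∃ C : ℝ, ∀ t x, 0 ≤ t → x ∈ Ioo (0 : ℝ) 1 →
      Real.exp (-C) * Real.exp (h 0 * t) ≤ Real.exp (∫ s in (-t)..0, h (x * Real.exp s)) ∧
      Real.exp (∫ s in (-t)..0, h (x * Real.exp s)) ≤ Real.exp C * Real.exp (h 0 * t) := by
  refine ⟨∫ y in Ioo (0 : ℝ) 1, |(h y - h 0) / y|, fun t x ht hx => ?_⟩
  have hx' := mul_exp_neg_mem_Ioo hx ht
  have := abs_le.1 (abs_intervalIntegral_le_unit (memLp_one_iff_integrable.1 hr) hx'.1.le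
    (mul_le_of_le_one_right hx.1.le (Real.exp_le_one_iff.2 (by linarith : -t ≤ 0))) hx.2.le)
  rw [integral_comp_mul_exp hc hx ht, ← Real.exp_add, ← Real.exp_add, Real.exp_le_exp,
    Real.exp_le_exp]
  constructor <;> linarith [this.1, this.2]

/-- No derivative of `h` is needed: after the substitution, `x` enters only through the endpoints of
the integral of `r`, and `r` is continuous on `(0, 1)`. -/
theorem hasDerivAt_weight {h : ℝ → ℝ} (hc : ContinuousOn h (Icc (0 : ℝ) 1)) {x t : ℝ}
    (hx : x ∈ Ioo (0 : ℝ) 1) (ht : 0 ≤ t) :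
    HasDerivAt (fun x => Real.exp (∫ s in (-t)..0, h (x * Real.exp s)))
      (Real.exp (∫ s in (-t)..0, h (x * Real.exp s)) *
        ((h x - h 0) / x - Real.exp (-t) *
          ((h (x * Real.exp (-t)) - h 0) / (x * Real.exp (-t))))) x := by
  refine HasDerivAt.exp ?_
  let r : ℝ → ℝ := fun y => (h y - h 0) / y
  have hrc : ContinuousOn r (Ioo (0 : ℝ) 1) :=
    (continuousOn_sub_div hc).mono Ioo_subset_Ioc_self
  have hprim : ∀ z ∈ Ioo (0 : ℝ) 1, HasDerivAt (fun z => ∫ y in x..z, r y) (r z) z := by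
    intro z hz
    refine intervalIntegral.integral_hasDerivAt_right ?_
      (hrc.stronglyMeasurableAtFilter isOpen_Ioo z hz) (hrc.continuousAt (isOpen_Ioo.mem_nhds hz))
    exact (hrc.mono (ordConnected_Ioo.uIcc_subset hx hz)).intervalIntegrable
  have hx' := mul_exp_neg_mem_Ioo hx ht
  have h1 := (hprim x hx).sub ((hprim _ hx').comp x ((hasDerivAt_id x).mul_const (Real.exp (-t))))
  have h2 := h1.const_add (h 0 * t)
  refine (h2.congr_of_eventuallyEq ?_).congr_deriv ?_
  · filter_upwards [isOpen_Ioo.mem_nhds hx] with z hz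
    have hz' := mul_exp_neg_mem_Ioo hz ht
    rw [integral_comp_mul_exp hc hz ht]
    have hi : ∀ w ∈ Ioo (0 : ℝ) 1, IntervalIntegrable r volume x w := fun w hw =>
      (hrc.mono (ordConnected_Ioo.uIcc_subset hx hw)).intervalIntegrable
    simp only [Pi.sub_apply, Function.comp, id]
    rw [intervalIntegral.integral_interval_sub_left (hi z hz) (hi _ hz')]
  · simp only [r]
    ring

/-- By continuity the set where `|r|` exceeds its essential supremum is open; being null, it is
empty. -/
theorem exists_abs_le_of_memLp_top {r : ℝ → ℝ} (hrc : ContinuousOn r (Ioo (0 : ℝ) 1))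
    (hr : MemLp r ∞ unitMeasure) : ∃ M : ℝ, 0 ≤ M ∧ ∀ x ∈ Ioo (0 : ℝ) 1, |r x| ≤ M := by
  refine ⟨(eLpNorm r ∞ unitMeasure).toReal, ENNReal.toReal_nonneg, ?_⟩
  set M := (eLpNorm r ∞ unitMeasure).toReal
  have h1 : ∀ᵐ x ∂unitMeasure, |r x| ≤ M := by
    filter_upwards [ae_le_eLpNormEssSup (f := r) (μ := unitMeasure)] with x hx
    rw [← eLpNorm_exponent_top] at hx
    have := ENNReal.toReal_mono hr.2.ne hx
    rwa [toReal_enorm, Real.norm_eq_abs] at this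
  have ho : IsOpen (Ioo (0 : ℝ) 1 ∩ {x | M < |r x|}) :=
    hrc.abs.isOpen_inter_preimage isOpen_Ioo isOpen_Ioi
  have h0 : volume (Ioo (0 : ℝ) 1 ∩ {x | M < |r x|}) = 0 := by
    have h2 := ae_iff.1 ((ae_restrict_iff' measurableSet_Ioo).1 h1)
    refine measure_mono_null (fun x hx => ?_) h2
    exact fun h => not_le.2 hx.2 (h hx.1)
  intro x hx
  by_contra hcon
  have : x ∈ Ioo (0 : ℝ) 1 ∩ {x | M < |r x|} := ⟨hx, not_le.1 hcon⟩
  rw [(ho.measure_eq_zero_iff volume).1 h0] at this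
  exact this

theorem eLpNorm_unit_le_of_forall_abs_le {q : ℝ≥0∞} (hq : q ≠ 0) {f : ℝ → ℝ} {B : ℝ}
    (hf : ∀ x ∈ Ioo (0 : ℝ) 1, |f x| ≤ B) : eLpNorm f q unitMeasure ≤ ENNReal.ofReal B := by
  have hB : 0 ≤ B := (abs_nonneg _).trans (hf (1 / 2) (by norm_num))
  refine (eLpNorm_mono_ae_real (g := fun _ => B) ?_).trans ?_
  · filter_upwards [ae_unitMeasure_mem] with x hx using hf x hx
  · rw [eLpNorm_const B hq (IsProbabilityMeasure.ne_zero unitMeasure)]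
    simp [Real.enorm_eq_ofReal hB]

/-! ### Stability on `L^p` -/

theorem isStableOn_lpSpace {p : ℝ} (hp : 1 ≤ p) {h : ℝ → ℝ} (hc : ContinuousOn h (Icc (0 : ℝ) 1))
    (hr : MemLp (fun x => (h x - h 0) / x) 1 unitMeasure) (h0 : h 0 ≤ -(1 / p)) :
    IsStableOn (lasota h) (lpSpace (ENNReal.ofReal p)) (lpNorm (ENNReal.ofReal p)) := by
  intro v hv
  obtain ⟨C, hC⟩ := exists_bounds_weight hc hr
  have hlim := ENNReal.Tendsto.const_mul (a := ENNReal.ofReal (Real.exp C))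
    (tendsto_eLpNorm_exp_mul_comp hp h0 hv) (Or.inr ENNReal.ofReal_ne_top)
  rw [mul_zero] at hlim
  refine tendsto_of_tendsto_of_tendsto_of_le_of_le' tendsto_const_nhds hlim
    (Eventually.of_forall fun _ => zero_le) ?_
  filter_upwards [eventually_ge_atTop 0] with t ht
  refine eLpNorm_le_mul_eLpNorm_of_ae_le_mul ?_ _
  filter_upwards [ae_unitMeasure_mem] with x hx
  rw [lasota, norm_mul, norm_mul, Real.norm_of_nonneg (Real.exp_pos _).le,
    Real.norm_of_nonneg (Real.exp_pos _).le, ← mul_assoc]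
  exact mul_le_mul_of_nonneg_right (hC t x ht hx).2 (norm_nonneg _)

/-- The orbit of a positive function that is a subsolution for the constant weight `h 0` does not
tend to zero. -/
theorem not_tendsto_eLpNorm_lasota {q : ℝ≥0∞} (hq : q ≠ 0) {h : ℝ → ℝ}
    (hc : ContinuousOn h (Icc (0 : ℝ) 1))
    (hr : MemLp (fun x => (h x - h 0) / x) 1 unitMeasure) {v : ℝ → ℝ} (hv : MemLp v q unitMeasure)
    (hpos : ∀ x ∈ Ioo (0 : ℝ) 1, 0 < v x)
    (hsub : ∀ t x, 0 ≤ t → x ∈ Ioo (0 : ℝ) 1 → v x ≤ Real.exp (h 0 * t) * v (x * Real.exp (-t))) :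
    ¬ Tendsto (fun t => eLpNorm (lasota h t v) q unitMeasure) atTop (𝓝 0) := by
  intro hlim
  obtain ⟨C, hC⟩ := exists_bounds_weight hc hr
  have hlim' := ENNReal.Tendsto.const_mul (a := ENNReal.ofReal (Real.exp C)) hlim
    (Or.inr ENNReal.ofReal_ne_top)
  rw [mul_zero] at hlim'
  -- At every time `t ≥ 0`, `v` is pointwise at most `exp C` times its orbit, so its norm would be
  -- bounded by a null limit.
  have hle : eLpNorm v q unitMeasure ≤ 0 := by
    refine ge_of_tendsto hlim' ?_
    filter_upwards [eventually_ge_atTop 0] with t ht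
    refine eLpNorm_le_mul_eLpNorm_of_ae_le_mul ?_ _
    filter_upwards [ae_unitMeasure_mem] with x hx
    have h1 := hpos _ (mul_exp_neg_mem_Ioo hx ht)
    rw [lasota, norm_mul, Real.norm_of_nonneg (Real.exp_pos _).le,
      Real.norm_of_nonneg (hpos x hx).le, Real.norm_of_nonneg h1.le]
    have h2 := (hC t x ht hx).1
    rw [Real.exp_neg, inv_mul_le_iff₀ (Real.exp_pos _)] at h2
    refine (hsub t x ht hx).trans ?_
    rw [← mul_assoc]
    exact mul_le_mul_of_nonneg_right h2 h1.le
  have hz := (eLpNorm_eq_zero_iff hv.1 hq).1 (nonpos_iff_eq_zero.1 hle)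
  obtain ⟨x, hx, hx'⟩ := (hz.and ae_unitMeasure_mem).exists
  exact (hpos x hx').ne' hx

theorem memLp_rpow_unit {p a : ℝ} (hp : 1 ≤ p) (ha : -(1 / p) < a) :
    MemLp (fun x : ℝ => x ^ a) (ENNReal.ofReal p) unitMeasure := by
  have hp0 : 0 < p := by linarith
  have hq0 : ENNReal.ofReal p ≠ 0 := by simpa using hp0
  have hqt : ENNReal.ofReal p ≠ ∞ := ENNReal.ofReal_ne_top
  have hap : -1 < a * p := by
    have := mul_lt_mul_of_pos_right ha hp0
    rwa [neg_mul, one_div, inv_mul_cancel₀ hp0.ne'] at this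
  rw [← integrable_norm_rpow_iff (by fun_prop) hq0 hqt,
    ENNReal.toReal_ofReal hp0.le]
  have h1 : IntegrableOn (fun x : ℝ => x ^ (a * p)) (Ioo 0 1) := by
    rw [← intervalIntegrable_iff_integrableOn_Ioo_of_le zero_le_one]
    exact intervalIntegral.intervalIntegrable_rpow' hap
  refine Integrable.congr h1 ?_
  filter_upwards [ae_unitMeasure_mem] with x hx
  rw [Real.norm_of_nonneg (Real.rpow_nonneg hx.1.le _), Real.rpow_mul hx.1.le]

/-- This makes `x ^ a` a fixed point of the semigroup with constant weight `a`, the witness against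
stability. -/
theorem rpow_eq_exp_mul_rpow {x : ℝ} (hx : 0 < x) (a t : ℝ) :
    x ^ a = Real.exp (a * t) * (x * Real.exp (-t)) ^ a := by
  rw [Real.mul_rpow hx.le (Real.exp_pos _).le, ← Real.exp_mul, mul_left_comm, ← Real.exp_add]
  rw [show a * t + -t * a = 0 by ring, Real.exp_zero, mul_one]

theorem not_tendsto_eLpNorm_lasota_rpow {p : ℝ} (hp : 1 ≤ p) {h : ℝ → ℝ}
    (hc : ContinuousOn h (Icc (0 : ℝ) 1))
    (hr : MemLp (fun x => (h x - h 0) / x) 1 unitMeasure) (h0 : -(1 / p) < h 0) :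
    ¬ Tendsto (fun t => eLpNorm (lasota h t fun x => x ^ h 0) (ENNReal.ofReal p) unitMeasure)
      atTop (𝓝 0) :=
  not_tendsto_eLpNorm_lasota (by simp; linarith) hc hr (memLp_rpow_unit hp h0)
    (fun _ hx => Real.rpow_pos_of_pos hx.1 _) fun t _ _ hx => (rpow_eq_exp_mul_rpow hx.1 _ t).le

theorem isStableOn_lpSpace_iff {p : ℝ} (hp : 1 ≤ p) {h : ℝ → ℝ}
    (hc : ContinuousOn h (Icc (0 : ℝ) 1))
    (hr : MemLp (fun x => (h x - h 0) / x) 1 unitMeasure) :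
    IsStableOn (lasota h) (lpSpace (ENNReal.ofReal p)) (lpNorm (ENNReal.ofReal p)) ↔
      h 0 ≤ -(1 / p) :=
  ⟨fun hs => not_lt.1 fun h0 => not_tendsto_eLpNorm_lasota_rpow hp hc hr h0
      (hs _ (memLp_rpow_unit hp h0)), isStableOn_lpSpace hp hc hr⟩

/-! ### Stability on the Sobolev spaces -/

/-- The weak derivative of an orbit, for an initial value that is a primitive. -/
theorem hasWeakDeriv_weight_mul {h g : ℝ → ℝ} (hc : ContinuousOn h (Icc (0 : ℝ) 1))
    (hr : MemLp (fun x => (h x - h 0) / x) ∞ unitMeasure) (hg : IntegrableOn g (Ioo 0 1)) (c : ℝ)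
    {t : ℝ} (ht : 0 ≤ t) :
    HasWeakDeriv (lasota h t fun x => c + ∫ y in (0 : ℝ)..x, g y) fun x =>
      Real.exp (∫ s in (-t)..0, h (x * Real.exp s)) *
        (((h x - h 0) / x - Real.exp (-t) *
          ((h (x * Real.exp (-t)) - h 0) / (x * Real.exp (-t)))) *
          (c + ∫ y in (0 : ℝ)..(x * Real.exp (-t)), g y) + Real.exp (-t) * g (x * Real.exp (-t))) := by
  obtain ⟨M, hM0, hM⟩ := exists_abs_le_of_memLp_top
    ((continuousOn_sub_div hc).mono Ioo_subset_Ioc_self) hr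
  obtain ⟨C, hC⟩ := exists_bounds_weight hc (hr.mono_exponent le_top)
  have he : Real.exp (-t) ≤ 1 := Real.exp_le_one_iff.2 (by linarith)
  -- The dilated primitive is itself a primitive, of `k`, so its absolute continuity and a.e.
  -- derivative need no chain rule.
  set k : ℝ → ℝ := fun y => Real.exp (-t) * g (y * Real.exp (-t)) with hk
  have hg1 : IntervalIntegrable g volume 0 1 := by
    rwa [intervalIntegrable_iff_integrableOn_Ioo_of_le zero_le_one]
  have hki : IntegrableOn k (Ioo 0 1) := by
    rw [← intervalIntegrable_iff_integrableOn_Ioo_of_le zero_le_one]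
    refine IntervalIntegrable.const_mul ?_ _
    have h1 : IntervalIntegrable g volume 0 (Real.exp (-t)) := by
      refine hg1.mono_set ?_
      rw [uIcc_of_le (Real.exp_pos _).le, uIcc_of_le zero_le_one]
      exact Icc_subset_Icc le_rfl he
    have h2 := h1.comp_mul_right (c := Real.exp (-t))
    simpa [(Real.exp_pos (-t)).ne'] using h2
  have hU : ∀ x, c + ∫ y in (0 : ℝ)..(x * Real.exp (-t)), g y = c + ∫ y in (0 : ℝ)..x, k y := by
    intro x
    rw [hk, intervalIntegral.integral_const_mul, intervalIntegral.integral_comp_mul_right _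
      (Real.exp_pos _).ne', zero_mul, smul_eq_mul, mul_inv_cancel_left₀ (Real.exp_pos _).ne']
  have hdef : (lasota h t fun x => c + ∫ y in (0 : ℝ)..x, g y) = fun x =>
      Real.exp (∫ s in (-t)..0, h (x * Real.exp s)) * (c + ∫ y in (0 : ℝ)..x, k y) := by
    funext x
    rw [lasota, hU]
  rw [hdef]
  refine hasWeakDeriv_of_absolutelyContinuous (fun a b ha hab hb => ?_) ?_
  · refine AbsolutelyContinuousOnInterval.fun_mul ?_
      (absolutelyContinuousOnInterval_const_add_primitive hki c ha.le hab.le hb.le)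
    -- The bound `M` on `r` bounds the derivative of the weight, which is therefore Lipschitz.
    refine LipschitzOnWith.absolutelyContinuousOnInterval
      (K := (Real.exp C * Real.exp (h 0 * t) * (M + M)).toNNReal) ?_
    rw [uIcc_of_le hab.le]
    have hsub : ∀ x ∈ Icc a b, x ∈ Ioo (0 : ℝ) 1 := fun x hx =>
      ⟨ha.trans_le hx.1, hx.2.trans_lt hb⟩
    refine (convex_Icc a b).lipschitzOnWith_of_nnnorm_hasDerivWithin_le
      (fun x hx => (hasDerivAt_weight hc (hsub x hx) ht).hasDerivWithinAt) fun x hx => ?_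
    rw [← NNReal.coe_le_coe, coe_nnnorm, Real.coe_toNNReal _ (by positivity), norm_mul,
      Real.norm_of_nonneg (Real.exp_pos _).le]
    refine mul_le_mul (hC t x ht (hsub x hx)).2 ?_ (norm_nonneg _) (by positivity)
    refine (norm_sub_le _ _).trans (add_le_add (hM x (hsub x hx)) ?_)
    rw [norm_mul, Real.norm_of_nonneg (Real.exp_pos _).le]
    exact (mul_le_of_le_one_left (norm_nonneg _) he).trans (hM _ (mul_exp_neg_mem_Ioo (hsub x hx) ht))
  · filter_upwards [ae_hasDerivAt_const_add_primitive hki c] with x hx hx'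
    refine ((hasDerivAt_weight hc hx' ht).mul (hx hx')).congr_deriv ?_
    rw [hU]
    ring

/-- Common core of both Sobolev criteria. The uniform bound `m` controls the orbit and the term
where the weight is differentiated; the term with `g` is an `L^p` orbit with exponent `h 0 - 1`. -/
theorem tendsto_sobolevNorm_lasota {p : ℝ} (hp : 1 ≤ p) {h : ℝ → ℝ}
    (hc : ContinuousOn h (Icc (0 : ℝ) 1))
    (hr : MemLp (fun x => (h x - h 0) / x) ∞ unitMeasure) (h0 : h 0 - 1 ≤ -(1 / p)) {u g : ℝ → ℝ}
    (hg : MemLp g (ENNReal.ofReal p) unitMeasure) {c : ℝ}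
    (hu : u =ᵐ[unitMeasure] fun x => c + ∫ y in (0 : ℝ)..x, g y) {m : ℝ → ℝ}
    (hm : Tendsto m atTop (𝓝 0)) (hbound : ∀ t x, 0 ≤ t → x ∈ Ioo (0 : ℝ) 1 →
      Real.exp (h 0 * t) * |c + ∫ y in (0 : ℝ)..(x * Real.exp (-t)), g y| ≤ m t) :
    Tendsto (fun t => sobolevNorm (ENNReal.ofReal p) (lasota h t u)) atTop (𝓝 0) := by
  have hq1 : 1 ≤ ENNReal.ofReal p := ENNReal.one_le_ofReal.2 hp
  have hq0 : ENNReal.ofReal p ≠ 0 := (zero_lt_one.trans_le hq1).ne'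
  have hgi : IntegrableOn g (Ioo 0 1) := hg.integrable hq1
  obtain ⟨M, hM0, hM⟩ := exists_abs_le_of_memLp_top
    ((continuousOn_sub_div hc).mono Ioo_subset_Ioc_self) hr
  obtain ⟨C, hC⟩ := exists_bounds_weight hc (hr.mono_exponent le_top)
  have l1 : Tendsto (fun t => ENNReal.ofReal (Real.exp C * m t)) atTop (𝓝 0) := by
    simpa using ENNReal.tendsto_ofReal (hm.const_mul (Real.exp C))
  have l2 : Tendsto (fun t => ENNReal.ofReal (Real.exp C * ((M + M) * m t))) atTop (𝓝 0) := by
    simpa using ENNReal.tendsto_ofReal ((hm.const_mul (M + M)).const_mul (Real.exp C))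
  have l3 := ENNReal.Tendsto.const_mul (a := ENNReal.ofReal (Real.exp C))
    (tendsto_eLpNorm_exp_mul_comp hp h0 hg) (Or.inr ENNReal.ofReal_ne_top)
  have l := l1.add (l2.add l3)
  simp only [mul_zero, add_zero] at l
  refine tendsto_of_tendsto_of_tendsto_of_le_of_le' tendsto_const_nhds l
    (Eventually.of_forall fun _ => zero_le) ?_
  filter_upwards [eventually_ge_atTop 0] with t ht
  have he : Real.exp (-t) ≤ 1 := Real.exp_le_one_iff.2 (by linarith)
  have hae : lasota h t u =ᵐ[unitMeasure] lasota h t fun x => c + ∫ y in (0 : ℝ)..x, g y := by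
    filter_upwards [ae_comp_mul_exp_neg hu ht] with x hx
    rw [lasota, lasota, hx]
  have hWU : ∀ x ∈ Ioo (0 : ℝ) 1, Real.exp (∫ s in (-t)..0, h (x * Real.exp s)) *
      |c + ∫ y in (0 : ℝ)..(x * Real.exp (-t)), g y| ≤ Real.exp C * m t := fun x hx => by
    refine (mul_le_mul_of_nonneg_right (hC t x ht hx).2 (abs_nonneg _)).trans ?_
    rw [mul_assoc]
    exact mul_le_mul_of_nonneg_left (hbound t x ht hx) (Real.exp_pos _).le
  refine add_le_add ?_ ?_
  · rw [eLpNorm_congr_ae hae]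
    refine eLpNorm_unit_le_of_forall_abs_le hq0 fun x hx => ?_
    rw [lasota, abs_mul, abs_of_pos (Real.exp_pos _)]
    exact hWU x hx
  -- The infimum is at most the norm of this one explicit weak derivative.
  refine (iInf₂_le _ ((hasWeakDeriv_weight_mul hc hr hgi c ht).congr hae.symm)).trans ?_
  have hmt : 0 ≤ m t := by
    have h2 := hbound t (1 / 2) ht (by norm_num)
    exact le_trans (by positivity) h2
  have hmeas : AEStronglyMeasurable (fun x =>
      Real.exp C * (Real.exp ((h 0 - 1) * t) * g (x * Real.exp (-t)))) unitMeasure :=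
    ((memLp_comp_mul_exp_neg hg ht).1.const_mul _).const_mul _
  refine (eLpNorm_mono_ae_real (g := (fun _ => Real.exp C * ((M + M) * m t)) + fun x =>
    |Real.exp C * (Real.exp ((h 0 - 1) * t) * g (x * Real.exp (-t)))|) ?_).trans ?_
  · filter_upwards [ae_unitMeasure_mem] with x hx
    have hrr : |(h x - h 0) / x - Real.exp (-t) *
          ((h (x * Real.exp (-t)) - h 0) / (x * Real.exp (-t)))| ≤ M + M := by
      refine (abs_sub _ _).trans (add_le_add (hM x hx) ?_)
      rw [abs_mul, abs_of_pos (Real.exp_pos _)]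
      exact (mul_le_of_le_one_left (abs_nonneg _) he).trans (hM _ (mul_exp_neg_mem_Ioo hx ht))
    rw [mul_add]
    refine (norm_add_le _ _).trans (add_le_add ?_ ?_)
    · rw [mul_left_comm, norm_mul, mul_left_comm (Real.exp C)]
      refine mul_le_mul hrr ?_ (norm_nonneg _) (by linarith)
      rw [norm_mul, Real.norm_of_nonneg (Real.exp_pos _).le]
      exact hWU x hx
    · beta_reduce
      rw [norm_mul, abs_mul, abs_mul, Real.norm_of_nonneg (Real.exp_pos _).le,
        abs_of_pos (Real.exp_pos _), abs_of_pos (Real.exp_pos _), norm_mul,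
        Real.norm_of_nonneg (Real.exp_pos _).le, ← mul_assoc, ← mul_assoc]
      refine mul_le_mul_of_nonneg_right ?_ (abs_nonneg _)
      rw [show (h 0 - 1) * t = h 0 * t + -t by ring, Real.exp_add, ← mul_assoc]
      exact mul_le_mul_of_nonneg_right (hC t x ht hx).2 (Real.exp_pos _).le
  · refine (eLpNorm_add_le aestronglyMeasurable_const hmeas.norm hq1).trans (add_le_add ?_ ?_)
    · refine eLpNorm_unit_le_of_forall_abs_le hq0 fun x _ => ?_
      rw [abs_of_nonneg (by positivity)]
    · refine eLpNorm_le_mul_eLpNorm_of_ae_le_mul (Eventually.of_forall fun x => ?_) _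
      rw [norm_norm, norm_mul, Real.norm_of_nonneg (Real.exp_pos _).le]

/-- A primitive vanishing at `0` gains a factor `exp (-t)` from the change of variables, and on a
probability space the `L^1` norm is at most the `L^p` norm. -/
theorem exp_mul_abs_primitive_le {p : ℝ} (hp : 1 ≤ p) {g : ℝ → ℝ}
    (hg : MemLp g (ENNReal.ofReal p) unitMeasure) (a : ℝ) {t x : ℝ} (ht : 0 ≤ t)
    (hx : x ∈ Ioo (0 : ℝ) 1) :
    Real.exp (a * t) * |∫ y in (0 : ℝ)..(x * Real.exp (-t)), g y| ≤
      (eLpNorm (fun y => Real.exp ((a - 1) * t) * g (y * Real.exp (-t)))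
        (ENNReal.ofReal p) unitMeasure).toReal := by
  have hq1 : 1 ≤ ENNReal.ofReal p := ENNReal.one_le_ofReal.2 hp
  set k : ℝ → ℝ := fun y => Real.exp ((a - 1) * t) * g (y * Real.exp (-t)) with hk
  have hkp : MemLp k (ENNReal.ofReal p) unitMeasure := (memLp_comp_mul_exp_neg hg ht).const_mul _
  have hki : IntegrableOn k (Ioo 0 1) := hkp.integrable hq1
  have h1 : Real.exp (a * t) * ∫ y in (0 : ℝ)..(x * Real.exp (-t)), g y
      = ∫ y in (0 : ℝ)..x, k y := by
    rw [hk, intervalIntegral.integral_const_mul, intervalIntegral.integral_comp_mul_right _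
      (Real.exp_pos _).ne', zero_mul, smul_eq_mul, ← mul_assoc, ← Real.exp_neg, ← Real.exp_add]
    congr 2
    ring
  rw [← abs_of_pos (Real.exp_pos (a * t)), ← abs_mul, h1]
  refine (abs_intervalIntegral_le_unit hki le_rfl hx.1.le hx.2.le).trans ?_
  have h2 : ∫ y in Ioo (0 : ℝ) 1, |k y| = (eLpNorm k 1 unitMeasure).toReal := by
    rw [eLpNorm_one_eq_lintegral_enorm]
    exact integral_norm_eq_lintegral_enorm hkp.1
  rw [h2]
  exact ENNReal.toReal_mono hkp.2.ne (eLpNorm_le_eLpNorm_of_exponent_le hq1 hkp.1)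

theorem isStableOn_sobolevStar {p : ℝ} (hp : 1 ≤ p) {h : ℝ → ℝ}
    (hc : ContinuousOn h (Icc (0 : ℝ) 1))
    (hr : MemLp (fun x => (h x - h 0) / x) ∞ unitMeasure) (h0 : h 0 ≤ 1 - 1 / p) :
    IsStableOn (lasota h) (sobolevStar (ENNReal.ofReal p))
      (sobolevNorm (ENNReal.ofReal p)) := by
  rintro u ⟨⟨-, g, hug, hg⟩, w, hw, hwu, hw0⟩
  have hgi : IntegrableOn g (Ioo 0 1) := hg.integrable (ENNReal.one_le_ofReal.2 hp)
  obtain ⟨c, hu⟩ := hug.exists_ae_eq_primitive hgi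
  have hac := absolutelyContinuousOnInterval_const_add_primitive hgi c le_rfl zero_le_one le_rfl
  have hUc := hac.continuousOn
  rw [uIcc_of_le zero_le_one] at hUc
  have heq : w =ᵐ[volume.restrict (Icc (0 : ℝ) 1)] fun x => c + ∫ y in (0 : ℝ)..x, g y := by
    rw [← restrict_Ioo_eq_restrict_Icc]
    exact hwu.trans hu
  -- Two continuous functions that agree a.e. on `[0, 1]` agree at the endpoint `0` too.
  have hc0 : c = 0 := by
    have := Measure.eqOn_Icc_of_ae_eq volume zero_ne_one heq hw hUc
      (left_mem_Icc.2 (zero_le_one' ℝ))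
    simpa [hw0] using this.symm
  subst hc0
  have h0' : h 0 - 1 ≤ -(1 / p) := by linarith
  refine tendsto_sobolevNorm_lasota hp hc hr h0' hg hu
    ((ENNReal.tendsto_toReal ENNReal.zero_ne_top).comp (tendsto_eLpNorm_exp_mul_comp hp h0' hg))
    fun t x ht hx => ?_
  rw [zero_add]
  exact exp_mul_abs_primitive_le hp hg _ ht hx

theorem isStableOn_sobolev {p : ℝ} (hp : 1 ≤ p) {h : ℝ → ℝ}
    (hc : ContinuousOn h (Icc (0 : ℝ) 1))
    (hr : MemLp (fun x => (h x - h 0) / x) ∞ unitMeasure) (h0 : h 0 < 0) :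
    IsStableOn (lasota h) (sobolev (ENNReal.ofReal p)) (sobolevNorm (ENNReal.ofReal p)) := by
  rintro u ⟨-, g, hug, hg⟩
  have hgi : IntegrableOn g (Ioo 0 1) := hg.integrable (ENNReal.one_le_ofReal.2 hp)
  obtain ⟨c, hu⟩ := hug.exists_ae_eq_primitive hgi
  have h0' : h 0 - 1 ≤ -(1 / p) := by
    have : 1 / p ≤ 1 := (div_le_one (by linarith)).2 hp
    linarith
  have hm : Tendsto (fun t => Real.exp (h 0 * t) * (|c| + ∫ y in Ioo (0 : ℝ) 1, |g y|)) atTop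
      (𝓝 0) := by
    have h1 : Tendsto (fun t => Real.exp (h 0 * t)) atTop (𝓝 0) :=
      Real.tendsto_exp_atBot.comp (tendsto_id.const_mul_atTop_of_neg h0)
    simpa using h1.mul_const (|c| + ∫ y in Ioo (0 : ℝ) 1, |g y|)
  refine tendsto_sobolevNorm_lasota hp hc hr h0' hg hu hm fun t x ht hx => ?_
  have hx' := mul_exp_neg_mem_Ioo hx ht
  refine mul_le_mul_of_nonneg_left ((abs_add_le _ _).trans (add_le_add le_rfl ?_))
    (Real.exp_pos _).le
  exact abs_intervalIntegral_le_unit hgi le_rfl hx'.1.le hx'.2.le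

/-- The derivative `a * x ^ (a - 1)` is in `L^p` because `a - 1 > -1/p`; since `p ≥ 1`, also `a >
0`, which gives the value `0` at `0`. -/
theorem rpow_mem_sobolevStar {p a : ℝ} (hp : 1 ≤ p) (ha : 1 - 1 / p < a) :
    (fun x : ℝ => x ^ a) ∈ sobolevStar (ENNReal.ofReal p) := by
  have h1p : 1 / p ≤ 1 := (div_le_one (by linarith)).2 hp
  have hpp : 0 < 1 / p := by positivity
  have ha0 : 0 < a := by linarith
  have hg : MemLp (fun x : ℝ => a * x ^ (a - 1)) (ENNReal.ofReal p) unitMeasure :=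
    (memLp_rpow_unit hp (by linarith)).const_mul a
  have hgi : IntegrableOn (fun x : ℝ => a * x ^ (a - 1)) (Ioo 0 1) :=
    hg.integrable (ENNReal.one_le_ofReal.2 hp)
  have heq : (fun x : ℝ => (0 : ℝ) + ∫ y in (0 : ℝ)..x, a * y ^ (a - 1)) = fun x : ℝ => x ^ a := by
    funext x
    rw [intervalIntegral.integral_const_mul, integral_rpow (Or.inl (by linarith)), sub_add_cancel,
      Real.zero_rpow ha0.ne']
    field_simp
    ring
  refine ⟨⟨memLp_rpow_unit hp (by linarith), _,
    heq ▸ hasWeakDeriv_const_add_primitive hgi 0, hg⟩, fun x => x ^ a,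
    (Real.continuous_rpow_const ha0.le).continuousOn, ae_eq_refl _, Real.zero_rpow ha0.ne'⟩

theorem one_mem_sobolev (q : ℝ≥0∞) : (fun _ : ℝ => (1 : ℝ)) ∈ sobolev q := by
  have h := hasWeakDeriv_const_add_primitive (g := fun _ => 0) integrableOn_zero 1
  simp only [intervalIntegral.integral_zero, add_zero] at h
  exact ⟨memLp_const 1, _, h, MemLp.zero'⟩

/-- Instability is thus already detected by the `L^p` part of the norm. -/
theorem tendsto_eLpNorm_of_tendsto_sobolevNorm {q : ℝ≥0∞} {F : ℝ → ℝ → ℝ}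
    (hF : Tendsto (fun t => sobolevNorm q (F t)) atTop (𝓝 0)) :
    Tendsto (fun t => eLpNorm (F t) q unitMeasure) atTop (𝓝 0) :=
  tendsto_of_tendsto_of_tendsto_of_le_of_le tendsto_const_nhds hF (fun _ => zero_le)
    fun _ => le_self_add

theorem isStableOn_sobolevStar_iff {p : ℝ} (hp : 1 ≤ p) {h : ℝ → ℝ}
    (hc : ContinuousOn h (Icc (0 : ℝ) 1))
    (hr : MemLp (fun x => (h x - h 0) / x) ∞ unitMeasure) :
    IsStableOn (lasota h) (sobolevStar (ENNReal.ofReal p)) (sobolevNorm (ENNReal.ofReal p)) ↔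
      h 0 ≤ 1 - 1 / p := by
  refine ⟨fun hs => not_lt.1 fun h0 => ?_, isStableOn_sobolevStar hp hc hr⟩
  refine not_tendsto_eLpNorm_lasota_rpow hp hc (hr.mono_exponent le_top) (by linarith)
    (tendsto_eLpNorm_of_tendsto_sobolevNorm (hs _ (rpow_mem_sobolevStar hp h0)))

theorem isStableOn_sobolev_iff {p : ℝ} (hp : 1 ≤ p) {h : ℝ → ℝ}
    (hc : ContinuousOn h (Icc (0 : ℝ) 1))
    (hr : MemLp (fun x => (h x - h 0) / x) ∞ unitMeasure) :
    IsStableOn (lasota h) (sobolev (ENNReal.ofReal p)) (sobolevNorm (ENNReal.ofReal p)) ↔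
      h 0 < 0 := by
  refine ⟨fun hs => not_le.1 fun h0 => ?_, isStableOn_sobolev hp hc hr⟩
  -- The constant `1` is the witness: `1 ≤ exp (h 0 * t)` holds even at `h 0 = 0`, so the inequality
  -- in the criterion is strict.
  refine not_tendsto_eLpNorm_lasota (by simp; linarith) hc (hr.mono_exponent le_top)
    (memLp_const 1) (fun _ _ => one_pos) (fun t x ht _ => ?_)
    (tendsto_eLpNorm_of_tendsto_sobolevNorm (hs _ (one_mem_sobolev _)))
  rw [mul_one]
  exact Real.one_le_exp (mul_nonneg h0 ht)

end FoersterLasota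

theorem theorem5 (p : ℝ) (hp : 1 ≤ p) (h : ℝ → ℝ) (hc : ContinuousOn h (Icc (0 : ℝ) 1)) :
    ((fun x => (h x - h 0) / x) ∈ FoersterLasota.lpSpace 1 →
      (FoersterLasota.IsStableOn (FoersterLasota.lasota h)
          (FoersterLasota.lpSpace (ENNReal.ofReal p))
          (FoersterLasota.lpNorm (ENNReal.ofReal p)) ↔
        h 0 ≤ -(1 / p))) ∧
    (h ∈ FoersterLasota.sobolev ⊤ →
      (fun x => (h x - h 0) / x) ∈ FoersterLasota.lpSpace ⊤ →
      (FoersterLasota.IsStableOn (FoersterLasota.lasota h)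
          (FoersterLasota.sobolevStar (ENNReal.ofReal p))
          (FoersterLasota.sobolevNorm (ENNReal.ofReal p)) ↔
        h 0 ≤ 1 - 1 / p) ∧
      (FoersterLasota.IsStableOn (FoersterLasota.lasota h)
          (FoersterLasota.sobolev (ENNReal.ofReal p))
          (FoersterLasota.sobolevNorm (ENNReal.ofReal p)) ↔
        h 0 < 0)) := by
  exact ⟨FoersterLasota.isStableOn_lpSpace_iff hp hc, fun _ hr =>
    ⟨FoersterLasota.isStableOn_sobolevStar_iff hp hc hr,
      FoersterLasota.isStableOn_sobolev_iff hp hc hr⟩⟩
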